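/- **Theorem 3.** For an integer $k\ge 1$ put $h=h(k)=\dfrac{3\cdot 2^{k-1}-(k+2)}{2^{k+1}-1}$; then $h<3/4$. There are absolute constants $C,B,M$ and a function $\delta(k,\epsilon)$, with $\delta(k,\epsilon)\to 0$ as $k\to\infty$ and $\epsilon\to 0^+$ jointly and $|\delta(k,\epsilon)|\le M$ for all $k\ge 2$ and $0<\epsilon\le 1$, such that the following holds. For every finite undirected unweighted graph $G$ with $n$ vertices, every integer $k\ge1$ and every real $0<\epsilon\le 1$, there is a $(1+\epsilon,\beta)$-spanner $H$ of $G$, that is, a subgraph $H$ of $G$ on the same vertex set such that $$\mathrm{dist}_H(u,v)\le(1+\epsilon)\,\mathrm{dist}_G(u,v)+\beta\qquad\text{for all vertices }u,v,$$ (distances between different components being infinite), where $$\beta=\left(\frac{(4+\delta(k,\epsilon))\,k}{\epsilon}\right)^{k-1}\ \text{ if }k\ge2,\qquad \beta=B\ \text{ if }k=1,$$ and the number of edges of $H$ is at most $$C\,(k/\epsilon)^{h}\,n^{1+\frac1{2^{k+1}-1}}.$$ -/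

import Mathlib

open Filter Topology

/-- `H` is an `(α, β)`-spanner of the unweighted graph `G`: a subgraph of `G` on the same vertex set
such that `dist_H(u,v) ≤ α * dist_G(u,v) + β` for all `u, v`. Distances between vertices in
different components are infinite, so the inequality says nothing when `dist_G(u,v) = ∞`,
and requires `dist_H(u,v)` to be finite when `dist_G(u,v)` is. -/
def IsSpanner {V : Type*} (G H : SimpleGraph V) (α β : ℝ) : Prop :=
  H ≤ G ∧ ∀ u v : V, G.Reachable u v →
    H.Reachable u v ∧ (H.dist u v : ℝ) ≤ α * (G.dist u v : ℝ) + β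

/-- The exponent `h = (3 * 2^(k-1) - (k+2)) / (2^(k+1) - 1)` (used for `k ≥ 1`). -/
noncomputable def spannerExponent (k : ℕ) : ℝ :=
  (3 * (2 : ℝ) ^ (k - 1) - ((k : ℝ) + 2)) / ((2 : ℝ) ^ (k + 1) - 1)

/-- The additive term `((4 + δ) k / ε)^(k-1)`; for `k = 1`, where the exponent vanishes,
it is the constant `B`. -/
noncomputable def spannerAdditiveTerm (B δ : ℝ) (k : ℕ) (ε : ℝ) : ℝ :=
  if k = 1 then B else ((4 + δ) * (k : ℝ) / ε) ^ (k - 1)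

/-! Centre sets `A 0 = V`, `A 1`, ..., `A (k+1) = ∅` thin out. The graph `H` is built so that two
centres of `A i` at bounded distance are either almost optimally joined in `H`, or the first one
reaches a centre of `A (i+1)` just as cheaply. Cut a path of length `ℓ^(i+1)` into pieces of length
`ℓ^i`. If some piece is badly served, only the first and the last bad piece matter: leave the path
for a nearby centre at the first, return at the last. This detour costs about four radii, and the
radius at scale `ℓ^i` is about `ℓ^i` (`ConnectsOrReaches.concat`, `ConnectsOrReaches.step`). The
error at scale `ℓ^k` is thus about `4kℓ^(k-1)`, an `ε` fraction once `ℓ` is about `4k/ε`. No centre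
is left at the top, so the path is always served. Level `i` pays, per pair in the balls, one
shortest path of length `O(ℓ^i)`. Greedy samples (`exists_sample`) of size `s` leave `O(|A|²/s)`
pairs, and path buying (`exists_path_buying`) removes the length factor at level 1. Balancing the
costs of all levels (`sampleSize`) gives the edge bound. -/

section Sampling

/-! ### Greedy choice of centres with few ball pairs. -/

open Classical in
/-- The pairs `(c, x)` of elements of `A` such that `x` is closer to `c` than all of `S`. -/
noncomputable def sampleBalls {α β : Type*} [LinearOrder β] (d : α → α → β) (A S : Finset α) :
    Finset (α × α) :=
  (A ×ˢ A).filter fun p => ∀ y ∈ S, d p.1 p.2 < d p.1 y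

variable {α β : Type*} [LinearOrder β] {d : α → α → β} {A S : Finset α}

theorem mem_sampleBalls {p : α × α} :
    p ∈ sampleBalls d A S ↔ (p.1 ∈ A ∧ p.2 ∈ A) ∧ ∀ y ∈ S, d p.1 p.2 < d p.1 y := by
  classical
  simp [sampleBalls]

theorem card_sampleBalls_le : (sampleBalls d A S).card ≤ A.card ^ 2 := by
  classical
  unfold sampleBalls
  refine (Finset.card_filter_le _ _).trans ?_
  rw [Finset.card_product, sq]

theorem card_sq_le_two_mul_card_filter_le (B : Finset α) (f : α → β) :
    B.card ^ 2 ≤ 2 * ((B ×ˢ B).filter fun p => f p.1 ≤ f p.2).card := by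
  classical
  have h1 : (B ×ˢ B) ⊆ ((B ×ˢ B).filter fun p => f p.1 ≤ f p.2) ∪
      ((B ×ˢ B).filter fun p => f p.1 ≤ f p.2).image Prod.swap := by
    rintro ⟨x, y⟩ h
    simp only [Finset.mem_union, Finset.mem_filter, Finset.mem_image, Finset.mem_product,
      Prod.exists] at h ⊢
    rcases le_total (f x) (f y) with h' | h'
    · exact Or.inl ⟨h, h'⟩
    · exact Or.inr ⟨y, x, ⟨⟨h.2, h.1⟩, h'⟩, rfl⟩
  have h2 := Finset.card_le_card h1
  have h3 := Finset.card_union_le ((B ×ˢ B).filter fun p => f p.1 ≤ f p.2)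
    (((B ×ˢ B).filter fun p => f p.1 ≤ f p.2).image Prod.swap)
  have h4 := Finset.card_image_le (s := (B ×ˢ B).filter fun p => f p.1 ≤ f p.2) (f := Prod.swap)
  rw [Finset.card_product, ← sq] at h2
  omega

/-- Some element of `A` removes at least the average number of pairs when added to `S`. -/
theorem exists_sampleBalls_insert [DecidableEq α] (hA : A.Nonempty) :
    ∃ x ∈ A, (sampleBalls d A S).card ^ 2 ≤ 2 * A.card ^ 2 *
      ((sampleBalls d A S).card - (sampleBalls d A (insert x S)).card : ℤ) := by
  classical
  set P := sampleBalls d A S with hP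
  set g : α → ℕ := fun x => (P.filter fun p => d p.1 x ≤ d p.1 p.2).card with hg
  have hins : ∀ x, (P.card : ℤ) - (sampleBalls d A (insert x S)).card = g x := by
    intro x
    have : sampleBalls d A (insert x S) = P.filter fun p => ¬ d p.1 x ≤ d p.1 p.2 := by
      ext p
      simp only [hP, mem_sampleBalls, Finset.mem_filter, Finset.forall_mem_insert, not_le]
      tauto
    rw [this, ← Finset.card_filter_add_card_filter_not (s := P) (fun p => d p.1 x ≤ d p.1 p.2)]
    push_cast
    ring
  set b : α → Finset α := fun c => A.filter fun x => ∀ y ∈ S, d c x < d c y with hb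
  have hPsum : P.card = ∑ c ∈ A, (b c).card := by
    rw [hP, sampleBalls, Finset.card_filter, Finset.sum_product]
    simp only [hb, Finset.card_filter]
  -- Double counting: in the ball of `c`, the element `x` removes `z` whenever `x` is no farther
  -- from `c`, which holds for at least half of the ordered pairs `(x, z)`.
  have hsum : ∑ c ∈ A, (b c).card ^ 2 ≤ 2 * ∑ x ∈ A, g x := by
    have hgx : ∀ x, g x = ∑ c ∈ A, ((b c).filter fun z => d c x ≤ d c z).card := by
      intro x
      simp only [hg, hP, sampleBalls, Finset.filter_filter, hb]
      rw [Finset.card_filter, Finset.sum_product]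
      simp only [Finset.card_filter]
    rw [Finset.sum_congr rfl fun x _ => hgx x, Finset.sum_comm, Finset.mul_sum]
    refine Finset.sum_le_sum fun c _ => (card_sq_le_two_mul_card_filter_le (b c) (d c)).trans ?_
    refine Nat.mul_le_mul_left 2 ?_
    rw [Finset.card_filter, Finset.sum_product]
    simp only [← Finset.card_filter]
    exact Finset.sum_le_sum_of_subset (Finset.filter_subset _ _)
  have hsq : P.card ^ 2 ≤ A.card * ∑ c ∈ A, (b c).card ^ 2 := by
    rw [hPsum]
    exact sq_sum_le_card_mul_sum_sq
  obtain ⟨x, hx, hmax⟩ := Finset.exists_max_image A g hA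
  refine ⟨x, hx, ?_⟩
  rw [hins]
  have h1 : ∑ y ∈ A, g y ≤ A.card * g x := by
    simpa using Finset.sum_le_card_nsmul A g (g x) hmax
  have h2 : P.card ^ 2 ≤ 2 * A.card ^ 2 * g x := by
    calc P.card ^ 2 ≤ A.card * (2 * (A.card * g x)) :=
          hsq.trans (Nat.mul_le_mul_left _ (hsum.trans (Nat.mul_le_mul_left 2 h1)))
      _ = _ := by ring
  exact_mod_cast h2

/-- With `M = 2|A|²`, each greedy step lowers the number `P` of pairs by at least `P²/M`; hence `P`
decays like `M/t`. -/
theorem exists_sample_nat (d : α → α → β) (A : Finset α) (t : ℕ) :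
    ∃ S ⊆ A, S.card ≤ t ∧ (sampleBalls d A S).card * t ≤ 2 * A.card ^ 2 := by
  classical
  rcases A.eq_empty_or_nonempty with rfl | hA
  · exact ⟨∅, by simp, by simp, by simp [sampleBalls]⟩
  induction t with
  | zero => exact ⟨∅, by simp, by simp, by simp⟩
  | succ t ih =>
    obtain ⟨S, hSA, hSt, hS⟩ := ih
    obtain ⟨x, hx, hgain⟩ := exists_sampleBalls_insert (d := d) (S := S) hA
    refine ⟨insert x S, Finset.insert_subset hx hSA, (Finset.card_insert_le _ _).trans (by omega),
      ?_⟩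
    have hle := card_sampleBalls_le (d := d) (A := A) (S := S)
    set P : ℕ := (sampleBalls d A S).card
    set P' : ℕ := (sampleBalls d A (insert x S)).card
    have hm : 0 < A.card := hA.card_pos
    set m : ℕ := A.card
    zify at hS hle hm ⊢
    have hM : (0 : ℤ) < 2 * (m : ℤ) ^ 2 := by positivity
    set M : ℤ := 2 * (m : ℤ) ^ 2
    have hPM : (P : ℤ) ≤ M := by nlinarith
    have ht : (0 : ℤ) ≤ t := by positivity
    have hP0 : (0 : ℤ) ≤ P := by positivity
    refine le_of_mul_le_mul_left ?_ hM
    have h1 : M * (P' * (t + 1)) ≤ (M * P - P ^ 2) * (t + 1) := by nlinarith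
    have h2 : (M * P - P ^ 2) * ((t : ℤ) + 1) = (M - P) * (P * t + P) := by ring
    have h3 : (M - P) * ((P : ℤ) * t + P) ≤ (M - P) * (M + P) :=
      mul_le_mul_of_nonneg_left (by linarith) (by linarith)
    nlinarith

/-- A set of at most `s` elements for which the balls have total size at most `4 |A|² / s`. -/
theorem exists_sample (d : α → α → β) (A : Finset α) {s : ℝ} (hs : 0 < s) :
    ∃ S ⊆ A, (s ≤ 1 → S = ∅) ∧ (S.card : ℝ) ≤ s ∧
      ((sampleBalls d A S).card : ℝ) * s ≤ 4 * (A.card : ℝ) ^ 2 := by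
  -- The value `s = 1` belongs to the empty sample: the last target size is exactly 1 and its level
  -- has to be empty.
  rcases le_or_gt s 1 with h | h
  · refine ⟨∅, by simp, fun _ => rfl, by simpa using hs.le, ?_⟩
    have h1 : ((sampleBalls d A ∅).card : ℝ) ≤ (A.card : ℝ) ^ 2 := by
      exact_mod_cast card_sampleBalls_le
    nlinarith [sq_nonneg (A.card : ℝ), Nat.cast_nonneg (α := ℝ) (sampleBalls d A ∅).card]
  · obtain ⟨S, hSA, hSt, hS⟩ := exists_sample_nat d A ⌊s⌋₊
    have hfl : (⌊s⌋₊ : ℝ) ≤ s := Nat.floor_le hs.le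
    have hfl2 : s ≤ 2 * (⌊s⌋₊ : ℝ) := by
      have h1 := Nat.lt_floor_add_one s
      have h2 : (1 : ℝ) ≤ ⌊s⌋₊ := by exact_mod_cast Nat.le_floor (by simpa using h.le)
      linarith
    refine ⟨S, hSA, fun h' => absurd h' (not_le.2 h), le_trans (by exact_mod_cast hSt) hfl, ?_⟩
    have h1 : ((sampleBalls d A S).card : ℝ) * ⌊s⌋₊ ≤ 2 * (A.card : ℝ) ^ 2 := by exact_mod_cast hS
    nlinarith [mul_le_mul_of_nonneg_left hfl2
      (Nat.cast_nonneg (α := ℝ) (sampleBalls d A S).card)]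

end Sampling

/-! ### Walks of bounded length. -/

namespace SimpleGraph

section Within

variable {V : Type*} {G H : SimpleGraph V} {u v w : V} {m n : ℕ}

/-- There is a walk from `u` to `v` of length at most `n`. -/
def Within (G : SimpleGraph V) (u v : V) (n : ℕ) : Prop := ∃ p : G.Walk u v, p.length ≤ n

theorem Within.refl (G : SimpleGraph V) (u : V) (n : ℕ) : G.Within u u n := ⟨.nil, by simp⟩

theorem Within.symm (h : G.Within u v n) : G.Within v u n := by
  obtain ⟨p, hp⟩ := h
  exact ⟨p.reverse, by simpa using hp⟩

theorem Within.trans (h : G.Within u v m) (h' : G.Within v w n) : G.Within u w (m + n) := by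
  obtain ⟨p, hp⟩ := h
  obtain ⟨q, hq⟩ := h'
  exact ⟨p.append q, by rw [Walk.length_append]; omega⟩

theorem Within.mono (h : G.Within u v m) (hmn : m ≤ n) : G.Within u v n := by
  obtain ⟨p, hp⟩ := h
  exact ⟨p, hp.trans hmn⟩

theorem Within.mono_graph (hGH : G ≤ H) (h : G.Within u v n) : H.Within u v n := by
  obtain ⟨p, hp⟩ := h
  exact ⟨p.mapLe hGH, by simpa using hp⟩

theorem Adj.within (h : G.Adj u v) : G.Within u v 1 := ⟨h.toWalk, by simp⟩

theorem Within.reachable (h : G.Within u v n) : G.Reachable u v := ⟨h.choose⟩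

theorem Within.dist_le (h : G.Within u v n) : G.dist u v ≤ n :=
  (SimpleGraph.dist_le h.choose).trans h.choose_spec

theorem Reachable.within (h : G.Reachable u v) : G.Within u v (G.dist u v) := by
  obtain ⟨p, hp⟩ := h.exists_walk_length_eq_dist
  exact ⟨p, hp.le⟩

theorem within_iff_edist_le : G.Within u v n ↔ G.edist u v ≤ n := by
  constructor
  · rintro ⟨p, hp⟩
    exact (edist_le p).trans (by exact_mod_cast hp)
  · intro h
    obtain ⟨p, hp⟩ := exists_walk_of_edist_ne_top (ne_top_of_le_ne_top (by simp) h)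
    exact ⟨p, by rw [← hp] at h; exact_mod_cast h⟩

theorem Within.edist_lt_edist (h : G.Within u v n) (h' : ¬ G.Within u w n) :
    G.edist u v < G.edist u w := by
  rw [within_iff_edist_le] at h h'
  exact h.trans_lt (not_le.1 h')

/-- A walk of length at most `m` can be cut after at most `n` steps. -/
theorem Within.exists_split (h : G.Within u v m) (n : ℕ) :
    ∃ w, G.Within u w (min n m) ∧ G.Within w v (m - n) := by
  obtain ⟨p, hp⟩ := h
  exact ⟨p.getVert n, ⟨p.take n, by rw [Walk.take_length]; omega⟩,
    ⟨p.drop n, by rw [Walk.drop_length]; omega⟩⟩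

theorem Within.exists_adj (h : G.Within u v (m + 1)) (huv : u ≠ v) :
    ∃ w, G.Adj u w ∧ G.Within w v m := by
  obtain ⟨p, hp⟩ := h
  cases p with
  | nil => exact absurd rfl huv
  | cons hadj q => exact ⟨_, hadj, q, by simpa using hp⟩

theorem within_of_adj {x : ℕ → V} {i j : ℕ} (hij : i ≤ j)
    (h : ∀ l, i ≤ l → l < j → G.Adj (x l) (x (l + 1))) : G.Within (x i) (x j) (j - i) := by
  induction j, hij using Nat.le_induction with
  | base => exact Within.refl _ _ _
  | succ j hij ih =>
    exact ((ih fun l hl hl' => h l hl (by omega)).trans (h j hij (by omega)).within).mono (by omega)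

end Within

/-! ### Sparse subgraphs that preserve chosen distances. -/

section Sparse

variable {V : Type*} {G : SimpleGraph V}

theorem ncard_edgeSet_sup_le (G H : SimpleGraph V) :
    (G ⊔ H).edgeSet.ncard ≤ G.edgeSet.ncard + H.edgeSet.ncard := by
  rw [edgeSet_sup]
  exact Set.ncard_union_le _ _

variable [Finite V]

theorem ncard_edgeSet_fromEdgeSet_le (s : Set (Sym2 V)) :
    (fromEdgeSet s).edgeSet.ncard ≤ s.ncard := by
  rw [edgeSet_fromEdgeSet]
  exact Set.ncard_le_ncard Set.sdiff_subset (Set.toFinite _)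

theorem ncard_edgeSet_mono {G H : SimpleGraph V} (h : G ≤ H) :
    G.edgeSet.ncard ≤ H.edgeSet.ncard :=
  Set.ncard_le_ncard (edgeSet_mono h) (Set.toFinite _)

/-- A forest of at most `|V|` edges preserving the distances to the set `S`. -/
theorem exists_forest (G : SimpleGraph V) (S : Set V) :
    ∃ F ≤ G, F.edgeSet.ncard ≤ Nat.card V ∧
      ∀ u m, (∃ s ∈ S, G.Within u s m) → ∃ s ∈ S, F.Within u s m := by
  -- The next vertex on a shortest walk to `S` serves all bounds `m` at once, so one edge per vertex
  -- suffices.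
  have key : ∀ u, ∃ v, ∀ m, u ∉ S → (∃ s ∈ S, G.Within u s (m + 1)) →
      G.Adj u v ∧ ∃ s ∈ S, G.Within v s m := by
    classical
    intro u
    by_cases h : u ∉ S ∧ ∃ m, ∃ s ∈ S, G.Within u s (m + 1)
    · obtain ⟨huS, hex⟩ := h
      obtain ⟨s, hs, hus⟩ := Nat.find_spec hex
      obtain ⟨v, huv, hvs⟩ := hus.exists_adj (fun h => huS (h ▸ hs))
      exact ⟨v, fun m _ hm => ⟨huv, s, hs, hvs.mono (Nat.find_min' hex hm)⟩⟩
    · push Not at h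
      exact ⟨u, fun m hu ⟨s, hs, hus⟩ => absurd hus (h hu m s hs)⟩
  choose f hf using key
  refine ⟨fromEdgeSet (Set.range fun v => s(v, f v)) ⊓ G, inf_le_right, ?_, ?_⟩
  · refine (ncard_edgeSet_mono inf_le_left).trans ((ncard_edgeSet_fromEdgeSet_le _).trans ?_)
    rw [← Set.image_univ]
    exact (Set.ncard_image_le (Set.toFinite _)).trans (by rw [Set.ncard_univ])
  · intro u m
    induction m generalizing u with
    | zero =>
      rintro ⟨s, hs, p, hp⟩
      obtain rfl := Walk.eq_of_length_eq_zero (Nat.le_zero.1 hp)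
      exact ⟨u, hs, Within.refl _ _ _⟩
    | succ m ih =>
      intro h
      by_cases hu : u ∈ S
      · exact ⟨u, hu, Within.refl _ _ _⟩
      · obtain ⟨hadj, h'⟩ := hf u m hu h
        obtain ⟨s, hs, hus⟩ := ih _ h'
        have hadj' : (fromEdgeSet (Set.range fun v => s(v, f v)) ⊓ G).Adj u (f u) := by
          rw [inf_adj, fromEdgeSet_adj]
          exact ⟨⟨⟨u, rfl⟩, hadj.ne⟩, hadj⟩
        exact ⟨s, hs, (hadj'.within.trans hus).mono (by omega)⟩

theorem exists_walk_subgraph {u v : V} (p : G.Walk u v) :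
    ∃ F ≤ G, F.edgeSet.ncard ≤ p.length ∧ F.Within u v p.length := by
  classical
  refine ⟨fromEdgeSet (p.edges.toFinset : Set (Sym2 V)), ?_, ?_, ?_⟩
  · intro a b hab
    rw [fromEdgeSet_adj] at hab
    exact p.adj_of_mem_edges (by simpa using hab.1)
  · refine (ncard_edgeSet_fromEdgeSet_le _).trans ?_
    rw [Set.ncard_coe_finset]
    exact (List.toFinset_card_le _).trans p.length_edges.le
  · refine ⟨p.transfer _ fun e he => ?_, by simp⟩
    rw [edgeSet_fromEdgeSet]
    exact ⟨by simpa using he, G.not_isDiag_of_mem_edgeSet (p.edges_subset_edgeSet he)⟩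

/-- A union of shortest paths preserving the distances up to `D` of the pairs in `T`. -/
theorem exists_pair_preserver (G : SimpleGraph V) (D : ℕ) (T : Finset (V × V)) :
    ∃ F ≤ G, F.edgeSet.ncard ≤ T.card * D ∧
      ∀ p ∈ T, ∀ m ≤ D, G.Within p.1 p.2 m → F.Within p.1 p.2 m := by
  classical
  induction T using Finset.induction_on with
  | empty => exact ⟨⊥, bot_le, by simp, by simp⟩
  | insert a T ha ih =>
    obtain ⟨F, hFG, hF, hT⟩ := ih
    by_cases h : G.Within a.1 a.2 D
    · obtain ⟨p, hp⟩ := h.reachable.exists_walk_length_eq_dist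
      obtain ⟨F', hF'G, hF', hp'⟩ := exists_walk_subgraph p
      have hpD : p.length ≤ D := hp ▸ h.dist_le
      refine ⟨F ⊔ F', sup_le hFG hF'G, ?_, ?_⟩
      · rw [Finset.card_insert_of_notMem ha]
        have := ncard_edgeSet_sup_le F F'
        linarith
      · intro q hq m hm hqm
        rcases Finset.mem_insert.1 hq with rfl | hq
        · exact (hp'.mono (hp ▸ hqm.dist_le)).mono_graph le_sup_right
        · exact (hT q hq m hm hqm).mono_graph le_sup_left
    · refine ⟨F, hFG, hF.trans (Nat.mul_le_mul_right _ (Finset.card_le_card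
        (Finset.subset_insert _ _))), ?_⟩
      intro q hq m hm hqm
      rcases Finset.mem_insert.1 hq with rfl | hq
      · exact absurd (hqm.mono hm) h
      · exact hT q hq m hm hqm

end Sparse

end SimpleGraph

/-! ### Path buying. -/

namespace SimpleGraph

section PathBuying

open Classical in
/-- The triples `(a, b, t)` with `(a, b) ∈ Q`, `t < 3`, and `dist_H(a, b) ≤ dist_G(a, b) + t`. -/
noncomputable def goodTriples {V : Type*} (G H : SimpleGraph V) (Q : Finset (V × V)) :
    Finset ((V × V) × ℕ) :=
  (Q ×ˢ Finset.range 3).filter fun q => H.Within q.1.1 q.1.2 (G.dist q.1.1 q.1.2 + q.2)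

variable {V : Type*} {G H H' : SimpleGraph V} {Q : Finset (V × V)}

theorem mem_goodTriples {q : (V × V) × ℕ} : q ∈ goodTriples G H Q ↔
    (q.1 ∈ Q ∧ q.2 < 3) ∧ H.Within q.1.1 q.1.2 (G.dist q.1.1 q.1.2 + q.2) := by
  classical
  simp [goodTriples]

theorem card_goodTriples_le : (goodTriples G H Q).card ≤ 3 * Q.card := by
  classical
  unfold goodTriples
  refine (Finset.card_filter_le _ _).trans ?_
  rw [Finset.card_product, Finset.card_range, mul_comm]

theorem goodTriples_mono (h : H ≤ H') : goodTriples G H Q ⊆ goodTriples G H' Q := by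
  intro q
  simp only [mem_goodTriples]
  exact fun ⟨h1, h2⟩ => ⟨h1, h2.mono_graph h⟩

/-- The good triples act as a potential: a pair first brought within `n`, at most 2 above its
distance in `G`, gains the triple with `t = n - dist`. -/
theorem exists_new_goodTriple (hH'G : H' ≤ G) {a b : V} {n : ℕ} (hQ : (a, b) ∈ Q)
    (h' : H'.Within a b n) (h : ¬ H.Within a b n) (hlow : ∀ r, G.Within a b r → n ≤ r + 2) :
    ∃ t, ((a, b), t) ∈ goodTriples G H' Q ∧ ((a, b), t) ∉ goodTriples G H Q := by
  have hG := h'.mono_graph hH'G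
  have h1 := hG.dist_le
  have h2 := hlow _ hG.reachable.within
  refine ⟨n - G.dist a b, ?_, ?_⟩ <;> simp only [mem_goodTriples]
  · rw [Nat.add_sub_cancel' h1]
    exact ⟨⟨hQ, by omega⟩, h'⟩
  · rw [Nat.add_sub_cancel' h1]
    exact fun h3 => h h3.2

variable [Finite V] {H₀ : SimpleGraph V} {A S : Finset V}

/-- Adding a shortest path between two badly connected centres pays for itself. -/
theorem exists_bought_path (hG : H₀ ≤ H) (hHG : H ≤ G)
    (hcl : ∀ u v, G.Adj u v → ¬ H₀.Adj u v → ∃ c ∈ A, H₀.Within u c 1)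
    {c c' : V} (hc : c ∈ A) (hc' : c' ∈ A) {m : ℕ} (hm : G.Within c c' m)
    (hS : ∀ s ∈ S, ¬ G.Within c s (m + 2)) (hbad : ¬ H.Within c c' (m + 2)) :
    ∃ H', H ≤ H' ∧ H' ≤ G ∧ H'.Within c c' m ∧ H'.edgeSet.ncard +
      6 * (goodTriples G H (sampleBalls G.edist A S)).card ≤
      H.edgeSet.ncard + 6 * (goodTriples G H' (sampleBalls G.edist A S)).card := by
  classical
  obtain ⟨p, hp⟩ := hm.reachable.exists_walk_length_eq_dist
  set D := G.dist c c' with hD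
  have hDm : D ≤ m := hm.dist_le
  have hmin : ∀ r, G.Within c c' r → D ≤ r := fun r hr => hr.dist_le
  set x : ℕ → V := p.getVert with hx
  have hx0 : x 0 = c := by simp [hx]
  have hxD : x D = c' := by simp [hx, ← hp]
  have hadj : ∀ j, j < D → G.Adj (x j) (x (j + 1)) := fun j hj =>
    p.adj_getVert_succ (by omega)
  -- Only the missing edges of a shortest path are paid for.
  set J := (Finset.range D).filter fun j => ¬ H.Adj (x j) (x (j + 1)) with hJ
  set E : Finset (Sym2 V) := J.image fun j => s(x j, x (j + 1)) with hE
  set H' := H ⊔ fromEdgeSet (E : Set (Sym2 V)) with hH'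
  have hHH' : H ≤ H' := le_sup_left
  have hadj' : ∀ j, j < D → H'.Adj (x j) (x (j + 1)) := by
    intro j hj
    by_cases h : H.Adj (x j) (x (j + 1))
    · exact hHH' h
    · refine (le_sup_right : _ ≤ H') ?_
      rw [fromEdgeSet_adj]
      refine ⟨?_, (hadj j hj).ne⟩
      simp only [hE, Finset.coe_image]
      exact ⟨j, by simp [hJ, hj, h], rfl⟩
  have hH'G : H' ≤ G := by
    refine sup_le hHG ?_
    intro a b hab
    rw [fromEdgeSet_adj, Finset.mem_coe, hE, Finset.mem_image] at hab
    obtain ⟨⟨j, hj, hje⟩, _⟩ := hab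
    have := hadj j (by simpa using (Finset.mem_filter.1 hj).1)
    rw [← mem_edgeSet, hje] at this
    exact this
  have hcard : H'.edgeSet.ncard ≤ H.edgeSet.ncard + J.card := by
    refine (ncard_edgeSet_sup_le _ _).trans (Nat.add_le_add_left ?_ _)
    refine (ncard_edgeSet_fromEdgeSet_le _).trans ?_
    rw [Set.ncard_coe_finset]
    exact Finset.card_image_le
  have hxx : ∀ i j, i ≤ j → j ≤ D → H'.Within (x i) (x j) (j - i) := fun i j hij hjD =>
    within_of_adj hij fun l _ hl => hadj' l (by omega)
  have hcx : ∀ j, j ≤ D → H'.Within c (x j) j := fun j hj => by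
    simpa [hx0] using hxx 0 j (by omega) hj
  have hxc' : ∀ j, j ≤ D → H'.Within (x j) c' (D - j) := fun j hj => by
    simpa [hxD] using hxx j D hj le_rfl
  have hcen : ∀ j, ∃ y, j ∈ J → y ∈ A ∧ H₀.Within (x j) y 1 := by
    intro j
    by_cases hj : j ∈ J
    · have hj' := Finset.mem_filter.1 hj
      obtain ⟨y, hy, hxy⟩ := hcl _ _ (hadj j (by simpa using hj'.1)) (fun h => hj'.2 (hG h))
      exact ⟨y, fun _ => ⟨hy, hxy⟩⟩
    · exact ⟨c, fun h => absurd h hj⟩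
  choose κ hκ using hcen
  have hJlt : ∀ j ∈ J, j < D := fun j hj => by simpa using (Finset.mem_filter.1 hj).1
  -- each centre serves at most three missing edges
  have hfib : J.card ≤ 3 * (J.image κ).card := by
    refine Finset.card_le_mul_card_image J 3 fun y hy => ?_
    obtain ⟨j, hj, rfl⟩ := Finset.mem_image.1 hy
    set F := J.filter fun i => κ i = κ j with hF
    have hne : F.Nonempty := ⟨j, by simp [hF, hj]⟩
    have hsub : F ⊆ Finset.Icc (F.min' hne) (F.min' hne + 2) := by
      intro i hi
      have hi₀ := F.min'_mem hne
      have hle := F.min'_le i hi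
      set i₀ := F.min' hne
      rw [hF, Finset.mem_filter] at hi hi₀
      have h1 := (hκ i hi.1).2
      have h2 := (hκ i₀ hi₀.1).2
      rw [hi.2] at h1
      rw [hi₀.2] at h2
      -- Two path vertices sharing a centre are within distance 2, so on a shortest path their
      -- indices differ by at most 2.
      have h3 : G.Within (x i₀) (x i) (1 + 1) := (h2.trans h1.symm).mono_graph (hG.trans hHG)
      have h4 := hmin _ ((((hcx i₀ (hJlt _ hi₀.1).le).mono_graph hH'G).trans h3).trans
        ((hxc' i (hJlt _ hi.1).le).mono_graph hH'G))
      have h5 := hJlt _ hi.1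
      rw [Finset.mem_Icc]
      omega
    exact (Finset.card_le_card hsub).trans (by rw [Nat.card_Icc]; omega)
  set P := sampleBalls G.edist A S
  set N := goodTriples G H' P \ goodTriples G H P with hN
  have hNcard : (goodTriples G H' P).card = (goodTriples G H P).card + N.card := by
    rw [hN, Finset.card_sdiff_of_subset (goodTriples_mono hHH')]
    have := Finset.card_le_card (goodTriples_mono (G := G) (Q := P) hHH')
    omega
  -- For a centre `y` beside the path, `H` cannot serve both `(c, y)` and `(y, c')` well, since
  -- together they would join `c` to `c'` within `D + 2`. One of the two pairs therefore improves; a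
  -- new triple is charged at most twice, once per coordinate. Both pairs lie in the balls because
  -- `S` is far from `c`.
  have hJN : (J.image κ).card ≤ 2 * N.card := by
    have hsub : J.image κ ⊆ (N.image fun t => t.1.2) ∪ (N.image fun t => t.1.1) := by
      intro y hy
      obtain ⟨j, hj, rfl⟩ := Finset.mem_image.1 hy
      have hjD := hJlt j hj
      obtain ⟨hyA, hxy⟩ := hκ j hj
      set y := κ j
      have hxy' : H'.Within (x j) y 1 := hxy.mono_graph (hG.trans hHH')
      have hcy : H'.Within c y (j + 1) := (hcx j hjD.le).trans hxy'
      have hyc' : H'.Within y c' (D - j + 1) := (hxy'.symm.trans (hxc' j hjD.le)).mono (by omega)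
      have hcyG := hcy.mono_graph hH'G
      have hyc'G := hyc'.mono_graph hH'G
      rw [Finset.mem_union, Finset.mem_image, Finset.mem_image]
      by_cases h1 : H.Within c y (j + 1)
      · have h2 : ¬ H.Within y c' (D - j + 1) := fun h2 =>
          hbad ((h1.trans h2).mono (by omega))
        obtain ⟨t, ht, ht'⟩ := exists_new_goodTriple (Q := P) hH'G (mem_sampleBalls.2
          ⟨⟨hyA, hc'⟩, fun s hs => hyc'G.edist_lt_edist fun h3 =>
            hS s hs ((hcyG.trans h3).mono (by omega))⟩) hyc' h2 (by
            intro r hr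
            have := hmin _ (hcyG.trans hr)
            omega)
        exact Or.inr ⟨_, by rw [hN, Finset.mem_sdiff]; exact ⟨ht, ht'⟩, rfl⟩
      · obtain ⟨t, ht, ht'⟩ := exists_new_goodTriple (Q := P) hH'G (mem_sampleBalls.2
          ⟨⟨hc, hyA⟩, fun s hs => hcyG.edist_lt_edist fun h3 =>
            hS s hs (h3.mono (by omega))⟩) hcy h1 (by
            intro r hr
            have := hmin _ (hr.trans hyc'G)
            omega)
        exact Or.inl ⟨_, by rw [hN, Finset.mem_sdiff]; exact ⟨ht, ht'⟩, rfl⟩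
    have h1 := Finset.card_le_card hsub
    have h2 := Finset.card_union_le (N.image fun t => t.1.2) (N.image fun t => t.1.1)
    have h3 := Finset.card_image_le (s := N) (f := fun t => t.1.2)
    have h4 := Finset.card_image_le (s := N) (f := fun t => t.1.1)
    omega
  have hfin : H'.Within c c' m := by
    have := (hcx D le_rfl).mono hDm
    rwa [hxD] at this
  exact ⟨H', hHH', hH'G, hfin, by omega⟩

/-- Path buying: with `O(1)` edges for each pair in the balls, the pairs of centres in `A` that are
clearly closer to each other than to `S` get additive stretch two. -/
theorem exists_path_buying (hH₀G : H₀ ≤ G)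
    (hcl : ∀ u v, G.Adj u v → ¬ H₀.Adj u v → ∃ c ∈ A, H₀.Within u c 1) :
    ∃ H, H₀ ≤ H ∧ H ≤ G ∧
      H.edgeSet.ncard ≤ H₀.edgeSet.ncard + 18 * (sampleBalls G.edist A S).card ∧
      ∀ c ∈ A, ∀ c' ∈ A, ∀ m, G.Within c c' m → (∀ s ∈ S, ¬ G.Within c s (m + 2)) →
        H.Within c c' (m + 2) := by
  set P := sampleBalls G.edist A S
  have hfin : {H : SimpleGraph V | H₀ ≤ H ∧ H ≤ G ∧ H.edgeSet.ncard ≤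
      H₀.edgeSet.ncard + 6 * (goodTriples G H P).card}.Finite := Set.toFinite _
  -- A maximal graph within the budget of 6 edges per good triple has no bad pair left; three
  -- triples per pair give the 18.
  obtain ⟨H, ⟨hH₀H, hHG, hcard⟩, hmax⟩ := hfin.exists_maximal ⟨H₀, le_rfl, hH₀G, by simp⟩
  refine ⟨H, hH₀H, hHG, ?_, ?_⟩
  · have := card_goodTriples_le (G := G) (H := H) (Q := P)
    omega
  · intro c hc c' hc' m hm hS
    by_contra hbad
    obtain ⟨H', hHH', hH'G, hw, hH'⟩ := exists_bought_path hH₀H hHG hcl hc hc' hm hS hbad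
    change _ + 6 * (goodTriples G H P).card ≤ _ + 6 * (goodTriples G H' P).card at hH'
    have := hmax ⟨hH₀H.trans hHH', hH'G, by omega⟩ hHH'
    exact hbad ((hw.mono_graph this).mono (by omega))

end PathBuying

end SimpleGraph

/-! ### Climbing from one scale to the next. -/

namespace SimpleGraph

section Hierarchy

variable {V : Type*} {G H H' : SimpleGraph V} {A S : Finset V} {b b' D D' L e R : ℕ}

/-- Every two centres in `A` at distance `m ≤ D` are connected by `H` with additive error `b`, or
else the first one is connected to a centre in `S` at distance `m + b`. -/
def IsLevel (G H : SimpleGraph V) (A S : Finset V) (b D : ℕ) : Prop :=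
  ∀ c ∈ A, ∀ c' ∈ A, ∀ m ≤ D, G.Within c c' m →
    H.Within c c' (m + b) ∨ ∃ s ∈ S, H.Within c s (m + b)

theorem IsLevel.mono (h : IsLevel G H A S b D) (hH : H ≤ H') (hb : b ≤ b') (hD : D' ≤ D) :
    IsLevel G H' A S b' D' := by
  intro c hc c' hc' m hm hw
  rcases h c hc c' hc' m (hm.trans hD) hw with h | ⟨s, hs, h⟩
  · exact Or.inl ((h.mono (by omega)).mono_graph hH)
  · exact Or.inr ⟨s, hs, (h.mono (by omega)).mono_graph hH⟩

/-- Every two vertices at distance `m ≤ L` are connected by `H` with additive error `e`, or else the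
first one is connected to a centre in `S` at distance `R`. -/
def ConnectsOrReaches (G H : SimpleGraph V) (S : Finset V) (L e R : ℕ) : Prop :=
  ∀ u v, ∀ m ≤ L, G.Within u v m → H.Within u v (m + e) ∨ ∃ w ∈ S, H.Within u w R

/-- Cut the walk into pieces of length at most `L`. Unless all are good, `w` is a centre near the
start of the first bad piece and `w'` one near the end of the last; `a`, `b`, `c` are the lengths
before, between and after, and `q₁`, `q₂` count the good pieces outside. The last conjunct only
serves the induction: it still bounds the distance to `w'` when a new bad first piece replaces `w`.
-/
theorem ConnectsOrReaches.concat (hHG : H ≤ G) (h : ConnectsOrReaches G H S L e R) (q : ℕ) :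
    ∀ m u v, m ≤ q * L → G.Within u v m → H.Within u v (m + q * e) ∨
      ∃ w ∈ S, ∃ w' ∈ S, ∃ a b c q₁ q₂, a + b + c = m ∧ q₁ + q₂ + 1 ≤ q ∧
        H.Within u w (a + q₁ * e + R) ∧ H.Within v w' (c + q₂ * e + R) ∧
        G.Within w w' (b + 2 * R) ∧ G.Within u w' (a + b + R) := by
  induction q with
  | zero =>
    intro m u v hm huv
    obtain ⟨p, hp⟩ := huv
    obtain rfl := Walk.eq_of_length_eq_zero (Nat.le_zero.1 (hp.trans (by simpa using hm)))
    exact Or.inl (Within.refl _ _ _)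
  | succ q ih =>
    intro m u v hm huv
    obtain ⟨x, hux, hxv⟩ := huv.exists_split L
    rw [Nat.add_mul, one_mul] at hm
    have hIH := ih (m - L) x v (by omega) hxv
    have hmL : min L m + (m - L) = m := by omega
    by_cases hgood : H.Within u x (min L m + e)
    · rcases hIH with hxv' | ⟨w, hw, w', hw', a, b, c, q₁, q₂, hm', hq, h1, h2, h3, h4⟩
      · left
        refine (hgood.trans hxv').mono ?_
        rw [Nat.add_mul, one_mul]
        omega
      · right
        refine ⟨w, hw, w', hw', min L m + a, b, c, q₁ + 1, q₂, by omega, by omega,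
          (hgood.trans h1).mono ?_, h2, h3, (hux.trans h4).mono (by omega)⟩
        rw [Nat.add_mul, one_mul]
        omega
    · right
      obtain ⟨w, hw, huw⟩ := (h u x _ (min_le_left _ _) hux).resolve_left hgood
      have huwG := huw.mono_graph hHG
      rcases hIH with hxv' | ⟨_, _, w', hw', a, b, c, q₁, q₂, hm', hq, _, h2, _, h4⟩
      -- The only bad piece is the first one; reversing it yields a centre near its far end.
      · obtain ⟨w', hw', hxw'⟩ := (h x u _ (min_le_left _ _) hux.symm).resolve_left
          fun h => hgood h.symm
        have hxw'G := hxw'.mono_graph hHG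
        refine ⟨w, hw, w', hw', 0, min L m, m - L, 0, q, by omega, by omega, huw.mono (by omega),
          (hxv'.symm.trans hxw'), ((huwG.symm.trans hux).trans hxw'G).mono (by omega),
          (hux.trans hxw'G).mono (by omega)⟩
      · exact ⟨w, hw, w', hw', 0, min L m + a + b, c, 0, q₂, by omega, by omega,
          huw.mono (by omega), h2, ((huwG.symm.trans hux).trans h4).mono (by omega),
          (hux.trans h4).mono (by omega)⟩

/-- The detour costs one `R` at each end and `2R + 2` between the centres, whence `4R + 2`. If the
level leads to `T` instead, the return at the far end is saved and `3R + 2` remains. -/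
theorem ConnectsOrReaches.step {T : Finset V} {ℓ : ℕ} (hHG : H ≤ G)
    (h : ConnectsOrReaches G H A L e R) (hlev : IsLevel G H A T 2 (ℓ * L + 2 * R)) :
    ConnectsOrReaches G H T (ℓ * L) (4 * R + 2 + ℓ * e) (ℓ * L + 3 * R + 2 + ℓ * e) := by
  intro u v m hm huv
  rcases h.concat hHG ℓ m u v hm huv with
    huv' | ⟨w, hw, w', hw', a, b, c, q₁, q₂, habc, hq, h1, h2, h3, -⟩
  · exact Or.inl (huv'.mono (by omega))
  · have hqe : q₁ * e + q₂ * e ≤ ℓ * e := by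
      rw [← Nat.add_mul]
      exact Nat.mul_le_mul_right _ (by omega)
    rcases hlev w hw w' hw' _ (by omega) h3 with h4 | ⟨s, hs, h4⟩
    · exact Or.inl (((h1.trans h4).trans h2.symm).mono (by omega))
    · exact Or.inr ⟨s, hs, (h1.trans h4).mono (by omega)⟩

/-- The radius and the additive error of the successive levels. -/
def radiusError (ℓ : ℕ) : ℕ → ℕ × ℕ
  | 0 => (1, 0)
  | i + 1 => (ℓ ^ (i + 1) + 3 * (radiusError ℓ i).1 + 2 + ℓ * (radiusError ℓ i).2,
      4 * (radiusError ℓ i).1 + 2 + ℓ * (radiusError ℓ i).2)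

theorem connectsOrReaches_of_isLevel [Fintype V] {A : ℕ → Finset V} {ℓ k : ℕ} (hHG : H ≤ G)
    (hA : A 0 = Finset.univ) (h0 : IsLevel G H (A 0) (A 1) 0 1)
    (h : ∀ i < k, IsLevel G H (A (i + 1)) (A (i + 2)) 2 (ℓ ^ (i + 1) + 2 * (radiusError ℓ i).1)) :
    ∀ i ≤ k, ConnectsOrReaches G H (A (i + 1)) (ℓ ^ i) (radiusError ℓ i).2 (radiusError ℓ i).1 := by
  intro i
  induction i with
  | zero =>
    intro _ u v m hm huv
    rcases h0 u (by simp [hA]) v (by simp [hA]) m (by simpa using hm) huv with h | ⟨s, hs, h⟩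
    · exact Or.inl h
    · exact Or.inr ⟨s, hs, h.mono (by simpa [radiusError] using hm)⟩
  | succ i ih =>
    intro hi
    have h1 := h i (by omega)
    rw [pow_succ'] at h1
    have h2 := (ih (by omega)).step hHG h1
    simpa only [radiusError, pow_succ'] using h2

/-- With no centres left, every piece is good, and a walk of length `m` has at most `m / L + 1`
pieces. -/
theorem ConnectsOrReaches.within (hHG : H ≤ G) (h : ConnectsOrReaches G H ∅ L e R) (hL : 0 < L)
    {u v : V} {m : ℕ} (huv : G.Within u v m) : H.Within u v (m + (m / L + 1) * e) := by
  have hm : m ≤ (m / L + 1) * L := by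
    have := Nat.div_add_mod m L
    have h2 := Nat.mod_lt m hL
    rw [Nat.add_mul, one_mul, mul_comm]
    omega
  rcases h.concat hHG _ m u v hm huv with h | ⟨w, hw, _⟩
  · exact h
  · simp at hw

end Hierarchy

end SimpleGraph

/-! ### Building the levels and counting edges. -/

namespace SimpleGraph

section Construction

variable {V : Type*} {G : SimpleGraph V} {A S : Finset V}

theorem exists_nearest (G : SimpleGraph V) (S : Finset V) (c : V) :
    ∃ y, ∀ m, (∃ s ∈ S, G.Within c s m) → y ∈ S ∧ G.Within c y m := by
  classical
  by_cases h : ∃ m, ∃ s ∈ S, G.Within c s m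
  · obtain ⟨s, hs, hcs⟩ := Nat.find_spec h
    exact ⟨s, fun m hm => ⟨hs, hcs.mono (Nat.find_min' h hm)⟩⟩
  · exact ⟨c, fun m hm => absurd ⟨m, hm⟩ h⟩

/-- The diagonal pairs lie in the balls, so the balls also pay for one path from each centre to its
nearest sample. -/
theorem card_sdiff_le_card_sampleBalls [DecidableEq V] (G : SimpleGraph V) (A S : Finset V) :
    (A \ S).card ≤ (sampleBalls G.edist A S).card := by
  refine Finset.card_le_card_of_injOn (fun c => (c, c)) ?_ ?_
  · intro c hc
    have hc' := Finset.mem_sdiff.1 hc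
    refine mem_sampleBalls.2 ⟨⟨hc'.1, hc'.1⟩, fun y hy => ?_⟩
    have hne : c ≠ y := fun h => hc'.2 (h ▸ hy)
    simpa using edist_pos_of_ne hne
  · intro a _ b _ hab
    simpa using hab

theorem exists_isLevel [Finite V] (G : SimpleGraph V) (A S : Finset V) (D : ℕ) :
    ∃ F ≤ G, F.edgeSet.ncard ≤ 2 * (sampleBalls G.edist A S).card * D ∧ IsLevel G F A S 0 D := by
  classical
  choose near hnear using exists_nearest G S
  obtain ⟨F, hFG, hF, hT⟩ := exists_pair_preserver G D
    (sampleBalls G.edist A S ∪ (A \ S).image fun c => (c, near c))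
  refine ⟨F, hFG, hF.trans (Nat.mul_le_mul_right _ ?_), ?_⟩
  · refine (Finset.card_union_le _ _).trans ?_
    have h1 := Finset.card_image_le (s := A \ S) (f := fun c => (c, near c))
    have h2 := card_sdiff_le_card_sampleBalls G A S
    omega
  · intro c hc c' hc' m hm hw
    by_cases h : ∃ s ∈ S, G.Within c s m
    · right
      by_cases hcS : c ∈ S
      · exact ⟨c, hcS, Within.refl _ _ _⟩
      · obtain ⟨h1, h2⟩ := hnear c m h
        refine ⟨near c, h1, hT (c, near c) ?_ m hm h2⟩
        exact Finset.mem_union_right _ (Finset.mem_image_of_mem _ (by simp [hc, hcS]))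
    · left
      push Not at h
      refine hT (c, c') (Finset.mem_union_left _ (mem_sampleBalls.2 ⟨⟨hc, hc'⟩, ?_⟩)) m hm hw
      exact fun s hs => hw.edist_lt_edist (h s hs)

theorem exists_isLevel_family [Finite V] (G : SimpleGraph V) (A : ℕ → Finset V) (D : ℕ → ℕ)
    (I : Finset ℕ) : ∃ F ≤ G,
      F.edgeSet.ncard ≤ ∑ i ∈ I, 2 * (sampleBalls G.edist (A i) (A (i + 1))).card * D i ∧
      ∀ i ∈ I, IsLevel G F (A i) (A (i + 1)) 0 (D i) := by
  classical
  induction I using Finset.induction_on with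
  | empty => exact ⟨⊥, bot_le, by simp, by simp⟩
  | insert i I hi ih =>
    obtain ⟨F, hFG, hF, hI⟩ := ih
    obtain ⟨F', hF'G, hF', hI'⟩ := exists_isLevel G (A i) (A (i + 1)) (D i)
    refine ⟨F' ⊔ F, sup_le hF'G hFG, ?_, ?_⟩
    · rw [Finset.sum_insert hi]
      exact (ncard_edgeSet_sup_le _ _).trans (Nat.add_le_add hF' hF)
    · intro j hj
      rcases Finset.mem_insert.1 hj with rfl | hj
      · exact hI'.mono le_sup_left le_rfl le_rfl
      · exact (hI j hj).mono le_sup_right le_rfl le_rfl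

/-- The edges of the vertices not adjacent to a centre, and two forests. -/
theorem exists_base [Fintype V] (G : SimpleGraph V) (A₁ A₂ : Finset V) : ∃ H ≤ G,
    H.edgeSet.ncard ≤ (sampleBalls G.edist Finset.univ A₁).card + 2 * Fintype.card V ∧
    (∀ u v, G.Adj u v → ¬ H.Adj u v → ∃ c ∈ A₁, H.Within u c 1) ∧
    ∀ u m, (∃ s ∈ A₂, G.Within u s m) → ∃ s ∈ A₂, H.Within u s m := by
  classical
  obtain ⟨F₁, hF₁G, hF₁, h₁⟩ := exists_forest G A₁
  obtain ⟨F₂, hF₂G, hF₂, h₂⟩ := exists_forest G A₂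
  set P := sampleBalls G.edist Finset.univ A₁
  set E : Finset (Sym2 V) := P.image fun p => s(p.1, p.2)
  set B := fromEdgeSet (E : Set (Sym2 V)) ⊓ G
  refine ⟨B ⊔ F₁ ⊔ F₂, sup_le (sup_le inf_le_right hF₁G) hF₂G, ?_, ?_, ?_⟩
  · have hB : B.edgeSet.ncard ≤ P.card := by
      refine (ncard_edgeSet_mono inf_le_left).trans ((ncard_edgeSet_fromEdgeSet_le _).trans ?_)
      rw [Set.ncard_coe_finset]
      exact Finset.card_image_le
    have h3 := ncard_edgeSet_sup_le B F₁
    have h4 := ncard_edgeSet_sup_le (B ⊔ F₁) F₂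
    rw [Nat.card_eq_fintype_card] at hF₁ hF₂
    omega
  · intro u v huv hnot
    by_cases h : ∃ c ∈ (A₁ : Set V), G.Within u c 1
    · obtain ⟨s, hs, hus⟩ := h₁ u 1 h
      exact ⟨s, hs, hus.mono_graph (le_sup_right.trans le_sup_left)⟩
    · push Not at h
      -- With no centre within distance 1 of `u`, every neighbour of `u` lies in its ball, so the
      -- edge was kept.
      refine absurd ?_ hnot
      refine (le_sup_left.trans le_sup_left : B ≤ B ⊔ F₁ ⊔ F₂) ?_
      rw [inf_adj, fromEdgeSet_adj]
      refine ⟨⟨Finset.mem_coe.2 (Finset.mem_image.2 ⟨(u, v), mem_sampleBalls.2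
        ⟨⟨Finset.mem_univ _, Finset.mem_univ _⟩, fun s hs => ?_⟩, rfl⟩), huv.ne⟩, huv⟩
      exact huv.within.edist_lt_edist (h s hs)
  · intro u m h
    obtain ⟨s, hs, hus⟩ := h₂ u m h
    exact ⟨s, hs, hus.mono_graph le_sup_right⟩

/-- Level 0 only concerns edges, level 1 comes from path buying at a cost independent of length, and
higher levels buy shortest paths. -/
theorem exists_hierarchy [Fintype V] (G : SimpleGraph V) (A : ℕ → Finset V) (D : ℕ → ℕ)
    (hA : A 0 = Finset.univ) (k : ℕ) : ∃ H ≤ G,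
      H.edgeSet.ncard ≤ 2 * Fintype.card V + (sampleBalls G.edist (A 0) (A 1)).card +
        18 * (sampleBalls G.edist (A 1) (A 2)).card +
        ∑ i ∈ Finset.Icc 2 k, 2 * (sampleBalls G.edist (A i) (A (i + 1))).card * D i ∧
      IsLevel G H (A 0) (A 1) 0 1 ∧ (∀ d, IsLevel G H (A 1) (A 2) 2 d) ∧
      ∀ i ∈ Finset.Icc 2 k, IsLevel G H (A i) (A (i + 1)) 0 (D i) := by
  obtain ⟨H₀, hH₀G, hH₀, hcl, hnear⟩ := exists_base G (A 1) (A 2)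
  obtain ⟨H₁, hH₀₁, hH₁G, hH₁, hpairs⟩ := exists_path_buying (S := A 2) hH₀G hcl
  obtain ⟨F, hFG, hF, hlev⟩ := exists_isLevel_family G A D (Finset.Icc 2 k)
  refine ⟨H₁ ⊔ F, sup_le hH₁G hFG, ?_, ?_, fun d => ?_,
    fun i hi => (hlev i hi).mono le_sup_right le_rfl le_rfl⟩
  · rw [hA]
    have := ncard_edgeSet_sup_le H₁ F
    omega
  · refine IsLevel.mono (H := H₀) ?_ (hH₀₁.trans le_sup_left) le_rfl le_rfl
    intro u _ v _ m hm huv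
    rcases eq_or_ne u v with rfl | hne
    · exact Or.inl (Within.refl _ _ _)
    · have hadj : m = 1 ∧ G.Adj u v := by
        obtain ⟨p, hp⟩ := huv
        have h0 : p.length ≠ 0 := fun h => hne (Walk.eq_of_length_eq_zero h)
        exact ⟨by omega, Walk.adj_of_length_eq_one (p := p) (by omega)⟩
      obtain ⟨rfl, hadj⟩ := hadj
      by_cases h : H₀.Adj u v
      · exact Or.inl h.within
      · exact Or.inr (hcl u v hadj h)
  · refine IsLevel.mono (H := H₁) (D := d) ?_ le_sup_left le_rfl le_rfl
    intro c hc c' hc' m _ hw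
    -- When path buying does not apply, the forest towards `A 2` gives the second alternative.
    by_cases h : ∃ s ∈ A 2, G.Within c s (m + 2)
    · obtain ⟨s, hs, hcs⟩ := hnear c _ h
      exact Or.inr ⟨s, hs, hcs.mono_graph hH₀₁⟩
    · push Not at h
      exact Or.inl (hpairs c hc c' hc' m hw h)

end Construction

end SimpleGraph

/-! ### Balancing the costs of the levels. -/

section SampleSizes

/-- The exponent of the path length in the target size of a sample. -/
def sampleExponent : ℕ → ℕ
  | 0 => 0
  | i + 1 => 2 * sampleExponent i + if i < 2 then 0 else i

/-- Target sizes for which all the levels of the construction cost about `N` edges. -/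
noncomputable def sampleSize (n N lam : ℝ) : ℕ → ℝ
  | 0 => n
  | i + 1 => sampleSize n N lam i ^ 2 * lam ^ (if i < 2 then 0 else i) / N

theorem sampleSize_pos {n N lam : ℝ} (hn : 0 < n) (hN : 0 < N) (hlam : 0 < lam) (i : ℕ) :
    0 < sampleSize n N lam i := by
  induction i with
  | zero => exact hn
  | succ i ih =>
    simp only [sampleSize]
    positivity

/-- The recursion in closed form, kept free of division. -/
theorem sampleSize_mul_pow {n N lam : ℝ} (hN : 0 < N) (i : ℕ) :
    sampleSize n N lam i * N ^ 2 ^ i = N * n ^ 2 ^ i * lam ^ sampleExponent i := by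
  induction i with
  | zero => simp [sampleSize, sampleExponent, mul_comm]
  | succ i ih =>
    simp only [sampleSize, sampleExponent]
    set j := if i < 2 then 0 else i
    rw [pow_succ 2 i, pow_mul N, pow_mul n, pow_add lam, mul_comm 2 (sampleExponent i), pow_mul lam]
    rw [show sampleSize n N lam i ^ 2 * lam ^ j / N * (N ^ 2 ^ i) ^ 2 =
      (sampleSize n N lam i * N ^ 2 ^ i) ^ 2 * lam ^ j / N by ring, ih]
    field_simp

theorem sampleExponent_succ {k : ℕ} (hk : 1 ≤ k) :
    (sampleExponent (k + 1) : ℝ) = 3 * 2 ^ (k - 1) - (k + 2) := by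
  induction k, hk using Nat.le_induction with
  | base => norm_num [sampleExponent]
  | succ k hk ih =>
    rw [sampleExponent, if_neg (by omega)]
    push_cast
    rw [ih]
    obtain ⟨j, rfl⟩ := Nat.exists_eq_add_of_le' hk
    simp only [Nat.add_sub_cancel, pow_succ]
    push_cast
    ring

theorem two_pow_succ_sub_one_pos (k : ℕ) : (0 : ℝ) < 2 ^ (k + 1) - 1 := by
  have : (1 : ℝ) ≤ 2 ^ k := one_le_pow₀ (by norm_num)
  rw [pow_succ]
  linarith

theorem spannerExponent_eq {k : ℕ} (hk : 1 ≤ k) :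
    spannerExponent k = sampleExponent (k + 1) / ((2 : ℝ) ^ (k + 1) - 1) := by
  rw [sampleExponent_succ hk, spannerExponent]

theorem spannerExponent_nonneg {k : ℕ} (hk : 1 ≤ k) : 0 ≤ spannerExponent k := by
  rw [spannerExponent_eq hk]
  exact div_nonneg (Nat.cast_nonneg _) (two_pow_succ_sub_one_pos k).le

theorem spannerExponent_lt {k : ℕ} (hk : 1 ≤ k) : spannerExponent k < 3 / 4 := by
  rw [spannerExponent, div_lt_iff₀ (two_pow_succ_sub_one_pos k)]
  obtain ⟨j, rfl⟩ := Nat.exists_eq_add_of_le' hk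
  simp only [Nat.add_sub_cancel, pow_succ]
  push_cast
  linarith [Nat.cast_nonneg (α := ℝ) j]

/-- This is the equation defining `N`: the closed form at `k + 1` equals 1 when `N^(2^(k+1)-1) =
n^(2^(k+1)) * lam^(sampleExponent (k+1))`. -/
theorem sampleSize_succ_eq_one {n lam : ℝ} (hn : 0 < n) (hlam : 0 < lam) {k : ℕ} (hk : 1 ≤ k) :
    sampleSize n (lam ^ spannerExponent k * n ^ (1 + 1 / ((2 : ℝ) ^ (k + 1) - 1))) lam (k + 1) =
      1 := by
  set N := lam ^ spannerExponent k * n ^ (1 + 1 / ((2 : ℝ) ^ (k + 1) - 1)) with hNdef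
  have hK := two_pow_succ_sub_one_pos k
  have hN : 0 < N := by positivity
  have h1 : N ^ ((2 : ℝ) ^ (k + 1) - 1) = n ^ 2 ^ (k + 1) * lam ^ sampleExponent (k + 1) := by
    rw [hNdef, Real.mul_rpow (by positivity) (by positivity), ← Real.rpow_mul hlam.le,
      ← Real.rpow_mul hn.le, spannerExponent_eq hk, div_mul_cancel₀ _ hK.ne', add_mul,
      div_mul_cancel₀ _ hK.ne', ← Real.rpow_natCast n, ← Real.rpow_natCast lam, mul_comm]
    congr 2
    push_cast
    ring
  clear_value N
  have h2 : N ^ 2 ^ (k + 1) = N * (n ^ 2 ^ (k + 1) * lam ^ sampleExponent (k + 1)) := by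
    rw [← h1, ← Real.rpow_one_add' hN.le (by linarith), ← Real.rpow_natCast]
    congr 1
    push_cast
    ring
  have h3 := sampleSize_mul_pow (n := n) (lam := lam) hN (k + 1)
  have h4 : (0 : ℝ) < N * (n ^ 2 ^ (k + 1) * lam ^ sampleExponent (k + 1)) := by positivity
  rw [h2, mul_assoc N] at h3
  exact (mul_eq_right₀ h4.ne').1 h3

end SampleSizes

/-! ### Sparse hierarchies from the balanced samples. -/

namespace SimpleGraph

section SparseHierarchy

variable {V : Type*} [Fintype V]

theorem exists_samples (G : SimpleGraph V) {s : ℕ → ℝ} (hs0 : s 0 = Fintype.card V)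
    (hs : ∀ i, 0 < s i) : ∃ A : ℕ → Finset V, A 0 = Finset.univ ∧
      (∀ i, s (i + 1) ≤ 1 → A (i + 1) = ∅) ∧
      ∀ i, ((sampleBalls G.edist (A i) (A (i + 1))).card : ℝ) * s (i + 1) ≤ 4 * s i ^ 2 := by
  choose f _ hf1 hf2 hf3 using fun (i : ℕ) (A : Finset V) => exists_sample G.edist A (hs (i + 1))
  set A : ℕ → Finset V := fun i => Nat.rec Finset.univ (fun i B => f i B) i with hA
  have hcard : ∀ i, ((A i).card : ℝ) ≤ s i := by
    intro i
    cases i with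
    | zero => simp [hA, hs0]
    | succ i => exact hf2 i (A i)
  refine ⟨A, rfl, fun i => hf1 i (A i), fun i => (hf3 i (A i)).trans ?_⟩
  exact mul_le_mul_of_nonneg_left (pow_le_pow_left₀ (Nat.cast_nonneg _) (hcard i) 2) (by norm_num)

theorem sum_Icc_two_inv_two_pow_le (k : ℕ) : ∑ i ∈ Finset.Icc 2 k, (1 / 2 : ℝ) ^ i ≤ 2 := by
  refine le_trans ?_ (sum_geometric_two_le (k + 1))
  refine Finset.sum_le_sum_of_subset_of_nonneg ?_ fun i _ _ => by positivity
  intro i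
  simp only [Finset.mem_Icc, Finset.mem_range]
  omega

theorem exists_sparse_hierarchy [Nonempty V] (G : SimpleGraph V) {k ℓ : ℕ} (hk : 1 ≤ k)
    (hℓ : 1 ≤ ℓ) : ∃ H ≤ G, ∃ A : ℕ → Finset V, A 0 = Finset.univ ∧ A (k + 1) = ∅ ∧
      (H.edgeSet.ncard : ℝ) ≤ 110 * ((2 * ℓ : ℝ) ^ spannerExponent k *
        (Fintype.card V : ℝ) ^ (1 + 1 / ((2 : ℝ) ^ (k + 1) - 1))) ∧
      IsLevel G H (A 0) (A 1) 0 1 ∧ (∀ d, IsLevel G H (A 1) (A 2) 2 d) ∧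
      ∀ i ∈ Finset.Icc 2 k, IsLevel G H (A i) (A (i + 1)) 0 (2 * ℓ ^ i) := by
  set n := (Fintype.card V : ℝ) with hn
  have hn1 : 1 ≤ n := by
    rw [hn]
    exact_mod_cast Fintype.card_pos
  have hℓ1 : (1 : ℝ) ≤ ℓ := by exact_mod_cast hℓ
  -- The factor 2 makes the cost of level `i` decay like `2^(-i)`, so summing over the levels loses
  -- no factor `k`.
  set lam : ℝ := 2 * ℓ with hlam
  have hlam1 : 1 ≤ lam := by linarith
  have hn0 : 0 < n := by linarith
  have hlam0 : 0 < lam := by linarith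
  have hlast := sampleSize_succ_eq_one hn0 hlam0 hk
  set N := lam ^ spannerExponent k * n ^ (1 + 1 / ((2 : ℝ) ^ (k + 1) - 1)) with hN
  have hN0 : 0 < N := by positivity
  have hnN : n ≤ N := by
    have h1 : 1 ≤ lam ^ spannerExponent k :=
      Real.one_le_rpow hlam1 (spannerExponent_nonneg hk)
    have h2 : n ^ (1 : ℝ) ≤ n ^ (1 + 1 / ((2 : ℝ) ^ (k + 1) - 1)) := by
      refine Real.rpow_le_rpow_of_exponent_le hn1 ?_
      have := one_div_nonneg.2 (two_pow_succ_sub_one_pos k).le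
      linarith
    rw [Real.rpow_one] at h2
    nlinarith
  have hpos := sampleSize_pos hn0 hN0 hlam0
  obtain ⟨A, hA0, hAempty, hballs⟩ := exists_samples G (s := sampleSize n N lam) rfl hpos
  have hball : ∀ i, ((sampleBalls G.edist (A i) (A (i + 1))).card : ℝ) *
      lam ^ (if i < 2 then 0 else i) ≤ 4 * N := by
    intro i
    have h1 := hballs i
    have h2 : 0 < sampleSize n N lam i ^ 2 := by
      have := hpos i
      positivity
    rw [sampleSize, ← mul_div_assoc, div_le_iff₀ hN0] at h1
    refine le_of_mul_le_mul_left ?_ h2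
    linarith
  obtain ⟨H, hHG, hH, hlev0, hlev1, hlev⟩ := exists_hierarchy G A (fun i => 2 * ℓ ^ i) hA0 k
  refine ⟨H, hHG, A, hA0, hAempty k hlast.le, ?_, hlev0, hlev1, hlev⟩
  have h0 := hball 0
  have h1 := hball 1
  simp only [Nat.ofNat_pos, Nat.one_lt_ofNat, if_true, pow_zero, mul_one, zero_add,
    one_add_one_eq_two] at h0 h1
  have h2 : ∑ i ∈ Finset.Icc 2 k, (2 * ((sampleBalls G.edist (A i) (A (i + 1))).card : ℝ) *
      (2 * (ℓ : ℝ) ^ i)) ≤ ∑ i ∈ Finset.Icc 2 k, 16 * N * (1 / 2 : ℝ) ^ i := by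
    refine Finset.sum_le_sum fun i hi => ?_
    have hi2 := (Finset.mem_Icc.1 hi).1
    have h3 := hball i
    rw [if_neg (by omega), hlam, mul_pow] at h3
    have h4 : (2 : ℝ) ^ i * (1 / 2 : ℝ) ^ i = 1 := by
      rw [← mul_pow]
      norm_num
    have h5 := mul_le_mul_of_nonneg_right h3 (by positivity : (0 : ℝ) ≤ (1 / 2 : ℝ) ^ i)
    calc 2 * ((sampleBalls G.edist (A i) (A (i + 1))).card : ℝ) * (2 * (ℓ : ℝ) ^ i)
        = 4 * (((sampleBalls G.edist (A i) (A (i + 1))).card : ℝ) * (ℓ : ℝ) ^ i *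
          ((2 : ℝ) ^ i * (1 / 2 : ℝ) ^ i)) := by rw [h4]; ring
      _ ≤ 16 * N * (1 / 2 : ℝ) ^ i := by linarith
  rw [← Finset.mul_sum] at h2
  have h3 := mul_le_mul_of_nonneg_left (sum_Icc_two_inv_two_pow_le k)
    (by positivity : (0 : ℝ) ≤ 16 * N)
  have h4 : (H.edgeSet.ncard : ℝ) ≤ 2 * n + (sampleBalls G.edist (A 0) (A 1)).card +
        18 * (sampleBalls G.edist (A 1) (A 2)).card +
        ∑ i ∈ Finset.Icc 2 k, (2 * ((sampleBalls G.edist (A i) (A (i + 1))).card : ℝ) *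
          (2 * (ℓ : ℝ) ^ i)) := by
    rw [hn]
    exact_mod_cast hH
  -- The constant is 110 = 2 + 4 + 18·4 + 16·2.
  linarith

end SparseHierarchy

end SimpleGraph

/-! ### Distortion of the hierarchy. -/

namespace SimpleGraph

section Distortion

/-- The extra 1 beside the radius absorbs the additive terms: `3R + 2 + 1 = 3(R + 1)` and `4R + 2 ≤
4(R + 1)`. -/
theorem radiusError_bound {ε : ℝ} (hε : 0 < ε) {k ℓ : ℕ}
    (hℓ : 4 * (1 + ε) * k + 4 ≤ ε * ℓ) (i : ℕ) (hi : i + 1 ≤ k) :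
    ((radiusError ℓ (i + 1)).1 : ℝ) + 1 ≤ (1 + ε) * (ℓ : ℝ) ^ (i + 1) ∧
      ((radiusError ℓ (i + 1)).2 : ℝ) ≤ (4 * (1 + ε) * (i + 1 : ℕ) + 4) * (ℓ : ℝ) ^ i := by
  induction i with
  | zero =>
    have hk : (1 : ℝ) ≤ k := by exact_mod_cast hi
    simp only [radiusError]
    push_cast
    constructor <;> nlinarith
  | succ i ih =>
    obtain ⟨h1, h2⟩ := ih (by omega)
    have hk : ((i : ℝ) + 2) ≤ k := by exact_mod_cast hi
    rw [radiusError]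
    set R : ℝ := ((radiusError ℓ (i + 1)).1 : ℝ)
    set e : ℝ := ((radiusError ℓ (i + 1)).2 : ℝ)
    have hℓ0 : (0 : ℝ) ≤ ℓ := Nat.cast_nonneg _
    have h3 : (ℓ : ℝ) * e ≤ (4 * (1 + ε) * (i + 1 : ℕ) + 4) * (ℓ : ℝ) ^ (i + 1) := by
      rw [pow_succ]
      nlinarith
    have hp : (0 : ℝ) ≤ (ℓ : ℝ) ^ (i + 1) := by positivity
    push_cast at h3 ⊢
    set p : ℝ := (ℓ : ℝ) ^ (i + 1)
    constructor
    · have h4 : 3 * (1 + ε) + (4 * (1 + ε) * ((i : ℝ) + 1) + 4) ≤ ε * ℓ := by nlinarith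
      have h5 := mul_le_mul_of_nonneg_right h4 hp
      rw [pow_succ _ (i + 1)]
      change p * ℓ + 3 * R + 2 + ℓ * e + 1 ≤ (1 + ε) * (p * ℓ)
      linarith
    · change 4 * R + 2 + ℓ * e ≤ (4 * (1 + ε) * ((i : ℝ) + 1 + 1) + 4) * p
      linarith

theorem radiusError_le {ε : ℝ} (hε : 0 < ε) {k ℓ : ℕ} (hk : 1 ≤ k)
    (hℓ : 4 * (1 + ε) * k + 4 ≤ ε * ℓ) :
    ((radiusError ℓ k).2 : ℝ) ≤ ε * ℓ * (ℓ : ℝ) ^ (k - 1) := by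
  obtain ⟨j, rfl⟩ := Nat.exists_eq_add_of_le' hk
  exact (radiusError_bound hε hℓ j le_rfl).2.trans
    (mul_le_mul_of_nonneg_right hℓ (by positivity))

/-- This is why paths of length `2ℓ^i` suffice at level `i`. -/
theorem pow_add_two_mul_radius_le {ε : ℝ} (hε : 0 < ε) (hε1 : ε ≤ 1) {k ℓ : ℕ}
    (hℓ : 4 * (1 + ε) * k + 4 ≤ ε * ℓ) (i : ℕ) (hi : i + 1 < k) :
    ℓ ^ (i + 2) + 2 * (radiusError ℓ (i + 1)).1 ≤ 2 * ℓ ^ (i + 2) := by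
  have h1 := (radiusError_bound hε hℓ i hi.le).1
  have hℓ4 : (4 : ℝ) ≤ ℓ := by
    have : (0 : ℝ) ≤ k := Nat.cast_nonneg _
    nlinarith
  have hp : (0 : ℝ) ≤ (ℓ : ℝ) ^ (i + 1) := by positivity
  have h2 : (2 * (radiusError ℓ (i + 1)).1 : ℝ) ≤ (ℓ : ℝ) ^ (i + 2) := by
    rw [pow_succ _ (i + 1)]
    nlinarith
  have h3 : 2 * (radiusError ℓ (i + 1)).1 ≤ ℓ ^ (i + 2) := by exact_mod_cast h2
  omega

variable {V : Type*} {G H : SimpleGraph V}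

theorem isSpanner_of_within {α β : ℝ} (hHG : H ≤ G)
    (h : ∀ u v m, G.Within u v m → ∃ r : ℕ, H.Within u v r ∧ (r : ℝ) ≤ α * m + β) :
    IsSpanner G H α β := by
  refine ⟨hHG, fun u v huv => ?_⟩
  obtain ⟨r, hr, hle⟩ := h u v _ huv.within
  exact ⟨hr.reachable, le_trans (by exact_mod_cast hr.dist_le) hle⟩

theorem isSpanner_of_levels [Fintype V] {A : ℕ → Finset V} {ℓ k : ℕ} {ε : ℝ} (hk : 1 ≤ k)
    (hε : 0 < ε) (hε1 : ε ≤ 1) (hℓ : 4 * (1 + ε) * k + 4 ≤ ε * ℓ) (hHG : H ≤ G)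
    (hA : A 0 = Finset.univ) (hAk : A (k + 1) = ∅) (h0 : IsLevel G H (A 0) (A 1) 0 1)
    (h1 : ∀ d, IsLevel G H (A 1) (A 2) 2 d)
    (h : ∀ i ∈ Finset.Icc 2 k, IsLevel G H (A i) (A (i + 1)) 0 (2 * ℓ ^ i)) :
    IsSpanner G H (1 + ε) (ε * ℓ * (ℓ : ℝ) ^ (k - 1)) := by
  have hℓ0 : 0 < ℓ := by
    rcases Nat.eq_zero_or_pos ℓ with rfl | h
    · have : (0 : ℝ) ≤ (1 + ε) * k := by positivity
      norm_num at hℓ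
      linarith
    · exact h
  have hlev : ∀ i < k, IsLevel G H (A (i + 1)) (A (i + 2)) 2
      (ℓ ^ (i + 1) + 2 * (radiusError ℓ i).1) := by
    intro i hi
    cases i with
    | zero => exact h1 _
    | succ i =>
      exact (h (i + 2) (Finset.mem_Icc.2 ⟨by omega, hi⟩)).mono le_rfl (by omega)
        (pow_add_two_mul_radius_le hε hε1 hℓ i hi)
  have hconn := connectsOrReaches_of_isLevel hHG hA h0 hlev k le_rfl
  rw [hAk] at hconn
  refine isSpanner_of_within hHG fun u v m huv =>
    ⟨_, hconn.within hHG (Nat.pow_pos hℓ0) huv, ?_⟩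
  have herr := radiusError_le hε hk hℓ
  set e : ℝ := ((radiusError ℓ k).2 : ℝ) with he
  have hq : ((m / ℓ ^ k : ℕ) : ℝ) * (ℓ : ℝ) ^ k ≤ m := by
    exact_mod_cast Nat.div_mul_le_self m (ℓ ^ k)
  have h2 : ε * ℓ * (ℓ : ℝ) ^ (k - 1) = ε * (ℓ : ℝ) ^ k := by
    rw [mul_assoc, ← pow_succ', Nat.sub_add_cancel hk]
  have h3 : ((m / ℓ ^ k : ℕ) : ℝ) * e ≤ ε * m :=
    calc ((m / ℓ ^ k : ℕ) : ℝ) * e ≤ ((m / ℓ ^ k : ℕ) : ℝ) * (ε * (ℓ : ℝ) ^ k) :=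
          mul_le_mul_of_nonneg_left (h2 ▸ herr) (Nat.cast_nonneg _)
      _ = ε * (((m / ℓ ^ k : ℕ) : ℝ) * (ℓ : ℝ) ^ k) := by ring
      _ ≤ ε * m := mul_le_mul_of_nonneg_left hq hε.le
  rw [Nat.cast_add, Nat.cast_mul, Nat.cast_add, Nat.cast_one, ← he, add_mul, one_mul]
  linarith

/-- With a single level of centres the spanner is additive. -/
theorem isSpanner_six [Fintype V] {A : ℕ → Finset V} {ε : ℝ} (hε : 0 < ε) (hHG : H ≤ G)
    (hA : A 0 = Finset.univ) (hA2 : A 2 = ∅) (h0 : IsLevel G H (A 0) (A 1) 0 1)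
    (h1 : ∀ d, IsLevel G H (A 1) (A 2) 2 d) : IsSpanner G H (1 + ε) 6 := by
  -- For one level the error `4·1 + 2 + ℓ·0` does not depend on `ℓ`, so `ℓ = m` treats the whole
  -- walk as one scale.
  refine isSpanner_of_within hHG fun u v m huv => ⟨m + 6, ?_, ?_⟩
  · have hconn := connectsOrReaches_of_isLevel (k := 1) (ℓ := m) hHG hA h0
      (fun i hi => by
        obtain rfl : i = 0 := by omega
        exact h1 _) 1 le_rfl
    rw [hA2] at hconn
    simpa [radiusError] using hconn u v m (by simp) huv
  · push_cast
    nlinarith [Nat.cast_nonneg (α := ℝ) m]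

end Distortion

end SimpleGraph

/-! ### The function `δ` and the choice of `ℓ`. -/

section AdditiveTerm

/-- The error term in the constant of the additive term. -/
noncomputable def spannerDelta (k : ℕ) (ε : ℝ) : ℝ :=
  (4 + 4 / k + 5 * ε) * (13 * (k : ℝ)) ^ (1 / ((k : ℝ) - 1)) - 4

theorem tendsto_spannerDelta :
    Tendsto (fun p : ℕ × ℝ => spannerDelta p.1 p.2) (atTop ×ˢ 𝓝[>] (0 : ℝ)) (𝓝 0) := by
  have hk : Tendsto (fun p : ℕ × ℝ => (p.1 : ℝ)) (atTop ×ˢ 𝓝[>] (0 : ℝ)) atTop :=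
    tendsto_natCast_atTop_atTop.comp tendsto_fst
  have hε : Tendsto (fun p : ℕ × ℝ => p.2) (atTop ×ˢ 𝓝[>] (0 : ℝ)) (𝓝 0) :=
    tendsto_snd.mono_right nhdsWithin_le_nhds
  have h1 : Tendsto (fun x : ℝ => (13 * x) ^ (1 / (x - 1))) atTop (𝓝 1) := by
    have h2 := (tendsto_rpow_div_mul_add 1 (1 / 13) (-1) (by norm_num)).comp
      (tendsto_id.const_mul_atTop (by norm_num : (0 : ℝ) < 13))
    refine h2.congr fun x => ?_
    simp only [Function.comp, id]
    congr 2
    ring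
  have h2 := (((hk.const_div_atTop 4).const_add 4).add (hε.const_mul 5)).mul (h1.comp hk)
  have h3 := h2.sub_const 4
  simpa [spannerDelta, Function.comp_def] using h3

theorem rpow_one_div_sub_one_le {k : ℕ} (hk : 2 ≤ k) :
    (13 * (k : ℝ)) ^ (1 / ((k : ℝ) - 1)) ≤ 27 := by
  have hk' : (2 : ℝ) ≤ k := by exact_mod_cast hk
  -- Bernoulli: `27^(k-1) ≥ 1 + 26(k-1) ≥ 13k` for `k ≥ 2`.
  have h1 : (13 * (k : ℝ)) ≤ 27 ^ (k - 1) := by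
    have h2 := one_add_mul_le_pow (by norm_num : (-2 : ℝ) ≤ 26) (k - 1)
    rw [Nat.cast_sub (by omega), Nat.cast_one] at h2
    norm_num at h2
    linarith
  have h3 := Real.rpow_le_rpow (by positivity) h1
    (one_div_nonneg.2 (by linarith : (0 : ℝ) ≤ (k : ℝ) - 1))
  refine h3.trans_eq ?_
  rw [← Real.rpow_natCast, ← Real.rpow_mul (by norm_num), Nat.cast_sub (by omega), Nat.cast_one,
    mul_one_div_cancel (by linarith), Real.rpow_one]

theorem abs_spannerDelta_le {k : ℕ} {ε : ℝ} (hk : 2 ≤ k) (hε : 0 < ε) (hε1 : ε ≤ 1) :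
    |spannerDelta k ε| ≤ 351 := by
  have hk' : (2 : ℝ) ≤ k := by exact_mod_cast hk
  have h1 := rpow_one_div_sub_one_le hk
  have h2 : (0 : ℝ) ≤ (13 * (k : ℝ)) ^ (1 / ((k : ℝ) - 1)) := by positivity
  have h3 : 4 / (k : ℝ) ≤ 4 := div_le_self (by norm_num) (by linarith)
  have h4 : 0 ≤ 4 / (k : ℝ) := by positivity
  rw [abs_le, spannerDelta]
  constructor <;> nlinarith

/-- A choice of the path length that meets the distortion requirement. -/
theorem exists_scale {k : ℕ} {ε : ℝ} (hk : 1 ≤ k) (hε : 0 < ε) (hε1 : ε ≤ 1) :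
    ∃ ℓ : ℕ, 1 ≤ ℓ ∧ 4 * (1 + ε) * k + 4 ≤ ε * ℓ ∧ ε * ℓ ≤ 13 * k ∧
      (ℓ : ℝ) ≤ (4 + 4 / k + 5 * ε) * k / ε := by
  have hk' : (1 : ℝ) ≤ k := by exact_mod_cast hk
  have hpos : 0 < (4 * (1 + ε) * k + 4) / ε := by positivity
  have h1 := Nat.le_ceil ((4 * (1 + ε) * k + 4) / ε)
  have h2 := Nat.ceil_lt_add_one hpos.le
  rw [div_le_iff₀ hε] at h1
  have h3 : (⌈(4 * (1 + ε) * k + 4) / ε⌉₊ : ℝ) * ε ≤ 4 * (1 + ε) * k + 4 + ε := by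
    have := mul_le_mul_of_nonneg_right h2.le hε.le
    rwa [add_mul, div_mul_cancel₀ _ hε.ne', one_mul] at this
  -- Rounding up adds at most `ε` to `ε * ℓ`; since `k ≥ 1`, `4(1+ε)k + 4 + ε` is at most `13k` and
  -- at most `4k + 4 + 5εk`.
  refine ⟨⌈(4 * (1 + ε) * k + 4) / ε⌉₊, Nat.ceil_pos.2 hpos, by linarith, by nlinarith, ?_⟩
  rw [le_div_iff₀ hε, add_mul, add_mul, div_mul_cancel₀ _ (by linarith)]
  nlinarith

/-- The surplus factor `ε * ℓ ≤ 13k` is spread over the `k - 1` factors as `(13k)^(1/(k-1))`, which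
tends to 1. -/
theorem le_spannerAdditiveTerm (B : ℝ) {k ℓ : ℕ} {ε : ℝ} (hk : 2 ≤ k)
    (h1 : ε * ℓ ≤ 13 * k) (h2 : (ℓ : ℝ) ≤ (4 + 4 / k + 5 * ε) * k / ε) :
    ε * ℓ * (ℓ : ℝ) ^ (k - 1) ≤ spannerAdditiveTerm B (spannerDelta k ε) k ε := by
  have hk' : (2 : ℝ) ≤ k := by exact_mod_cast hk
  rw [spannerAdditiveTerm, if_neg (by omega), spannerDelta, add_sub_cancel]
  set X : ℝ := 4 + 4 / k + 5 * ε
  have hY : ((13 * (k : ℝ)) ^ (1 / ((k : ℝ) - 1))) ^ (k - 1) = 13 * k := by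
    rw [← Real.rpow_natCast, ← Real.rpow_mul (by positivity), Nat.cast_sub (by omega),
      Nat.cast_one, one_div_mul_cancel (by linarith), Real.rpow_one]
  rw [show X * (13 * (k : ℝ)) ^ (1 / ((k : ℝ) - 1)) * k / ε =
    (13 * (k : ℝ)) ^ (1 / ((k : ℝ) - 1)) * (X * k / ε) by ring, mul_pow, hY]
  exact mul_le_mul h1 (pow_le_pow_left₀ (Nat.cast_nonneg _) h2 _) (by positivity) (by positivity)

theorem two_mul_rpow_spannerExponent_le {k ℓ : ℕ} {ε : ℝ} (hk : 1 ≤ k) (hε : 0 < ε)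
    (h : ε * ℓ ≤ 13 * k) :
    (2 * ℓ : ℝ) ^ spannerExponent k ≤ 26 * ((k : ℝ) / ε) ^ spannerExponent k := by
  have h0 := spannerExponent_nonneg hk
  have h1 : (2 * ℓ : ℝ) ≤ 26 * ((k : ℝ) / ε) := by
    rw [← mul_div_assoc, le_div_iff₀ hε]
    linarith
  refine (Real.rpow_le_rpow (by positivity) h1 h0).trans ?_
  rw [Real.mul_rpow (by norm_num) (by positivity)]
  refine mul_le_mul_of_nonneg_right ?_ (by positivity)
  refine (Real.rpow_le_rpow_of_exponent_le (by norm_num) ?_).trans_eq (Real.rpow_one 26)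
  linarith [spannerExponent_lt hk]

end AdditiveTerm

/-! ### Assembly. -/

theorem theorem3 :
    (∀ k : ℕ, 1 ≤ k → spannerExponent k < 3 / 4) ∧
    ∃ (C B M : ℝ) (δ : ℕ → ℝ → ℝ),
      Tendsto (fun p : ℕ × ℝ => δ p.1 p.2) (atTop ×ˢ 𝓝[>] (0 : ℝ)) (𝓝 0) ∧
      (∀ (k : ℕ) (ε : ℝ), 2 ≤ k → 0 < ε → ε ≤ 1 → |δ k ε| ≤ M) ∧
      ∀ (V : Type*) [Fintype V] (G : SimpleGraph V) (k : ℕ) (ε : ℝ),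
        1 ≤ k → 0 < ε → ε ≤ 1 →
        ∃ H : SimpleGraph V,
          IsSpanner G H (1 + ε) (spannerAdditiveTerm B (δ k ε) k ε) ∧
          (H.edgeSet.ncard : ℝ) ≤
            C * ((k : ℝ) / ε) ^ spannerExponent k *
              (Fintype.card V : ℝ) ^ (1 + 1 / ((2 : ℝ) ^ (k + 1) - 1)) := by
  refine ⟨fun k hk => spannerExponent_lt hk, 110 * 26, 6, 351, spannerDelta, tendsto_spannerDelta,
    fun k ε hk hε hε1 => abs_spannerDelta_le hk hε hε1, ?_⟩
  intro V _ G k ε hk hε hε1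
  -- The balanced sample sizes need at least one vertex.
  rcases isEmpty_or_nonempty V with hV | hV
  · refine ⟨⊥, ⟨bot_le, fun u => hV.elim u⟩, ?_⟩
    rw [SimpleGraph.edgeSet_bot, Set.ncard_empty, Nat.cast_zero]
    positivity
  · obtain ⟨ℓ, hℓ1, hℓ, hℓk, hℓle⟩ := exists_scale hk hε hε1
    obtain ⟨H, hHG, A, hA, hAk, hcard, h0, h1, h⟩ := G.exists_sparse_hierarchy hk hℓ1
    refine ⟨H, ?_, ?_⟩
    · rcases hk.eq_or_lt with rfl | hk2
      · rw [spannerAdditiveTerm, if_pos rfl]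
        exact SimpleGraph.isSpanner_six hε hHG hA hAk h0 h1
      · obtain ⟨hle, hsp⟩ := SimpleGraph.isSpanner_of_levels hk hε hε1 hℓ hHG hA hAk h0 h1 h
        refine ⟨hle, fun u v huv => ⟨(hsp u v huv).1, (hsp u v huv).2.trans ?_⟩⟩
        have := le_spannerAdditiveTerm 6 hk2 hℓk hℓle
        linarith
    · refine hcard.trans ?_
      rw [← mul_assoc]
      refine mul_le_mul_of_nonneg_right ?_ (by positivity)
      have := two_mul_rpow_spannerExponent_le hk hε hℓk
      linarith
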